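/- All graphs are finite and simple. For a connected graph $G$ with vertex set $V(G)$ and distance $d$, a set $S\subseteq V(G)$ is a resolving set if for every two distinct vertices $x,y$ there is $s\in S$ with $d(x,s)\ne d(y,s)$; the metric dimension $\dim(G)$ is the minimum cardinality of a resolving set for $G$. For graphs $G$ and $H$, the corona product $G\odot H$ is obtained from one copy of $G$ and $|V(G)|$ copies of $H$, one for each vertex $v$ of $G$, by joining $v$ to every vertex of its copy of $H$. Put $G\odot^1 H=G\odot H$ and $G\odot^k H=(G\odot^{k-1}H)\odot H$ for $k\ge 2$. Let $K_1$ be the one-vertex graph, and let $n_1(G)$ be the number of vertices of degree one in $G$. **Theorem.** For every tree $T$ of order $n\ge 3$, $$\dim(T\odot^k K_1)=\begin{cases} n_1(T) & \text{for } k=1,\\ 2^{k-2}\,n & \text{for every integer } k\ge 2.\end{cases}$$ -/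

import Mathlib

namespace MetricDimension

universe u v

/-- A set `S` of vertices of a graph `G` is a resolving set if distinct vertices have distinct
vectors of distances to the elements of `S`. -/
def IsResolvingSet {V : Type u} (G : SimpleGraph V) (S : Set V) : Prop :=
  ∀ x y : V, x ≠ y → ∃ s ∈ S, G.dist x s ≠ G.dist y s

/-- The metric dimension of `G`: the minimum cardinality of a resolving set for `G`. -/
noncomputable def metricDim {V : Type u} (G : SimpleGraph V) : ℕ∞ :=
  ⨅ (S : Set V) (_ : IsResolvingSet G S), S.encard

/-- Adjacency in the corona product: `Sum.inl a` is the vertex `a` of `G`, and `Sum.inr (a, x)` is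
the vertex `x` in the copy of `H` that belongs to the vertex `a` of `G`. -/
def coronaAdj {V : Type u} {W : Type v} (G : SimpleGraph V) (H : SimpleGraph W) :
    V ⊕ (V × W) → V ⊕ (V × W) → Prop
  | Sum.inl a, Sum.inl b => G.Adj a b
  | Sum.inl a, Sum.inr (b, _) => a = b
  | Sum.inr (a, _), Sum.inl b => a = b
  | Sum.inr (a, x), Sum.inr (b, y) => a = b ∧ H.Adj x y

/-- The corona product of `G` and `H`: one copy of `G` and, for each vertex `a` of `G`, one copy
of `H`, all of whose vertices are joined to `a`. -/
def corona {V : Type u} {W : Type v} (G : SimpleGraph V) (H : SimpleGraph W) :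
    SimpleGraph (V ⊕ (V × W)) where
  Adj := coronaAdj G H
  symm := ⟨by
    rintro (a | ⟨a, x⟩) (b | ⟨b, y⟩) h
    · exact SimpleGraph.Adj.symm (G := G) h
    · exact Eq.symm h
    · exact Eq.symm h
    · exact ⟨h.1.symm, SimpleGraph.Adj.symm h.2⟩⟩
  loopless := ⟨by
    rintro (a | ⟨a, x⟩) h
    · exact G.ne_of_adj h rfl
    · exact H.ne_of_adj h.2 rfl⟩

/-- The vertex type of the `k`-fold iterated corona product. -/
def IterCoronaVertex (V W : Type u) : ℕ → Type u
  | 0 => V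
  | k + 1 => IterCoronaVertex V W k ⊕ (IterCoronaVertex V W k × W)

/-- The `k`-fold iterated corona product of `G` with `H`: for `k = 0` it is `G`, for `k = 1` it is
the corona product of `G` and `H`, and the graph for `k + 1` is the corona product of the graph
for `k` with `H`. -/
def iterCorona {V W : Type u} (G : SimpleGraph V) (H : SimpleGraph W) :
    (k : ℕ) → SimpleGraph (IterCoronaVertex V W k)
  | 0 => G
  | k + 1 => corona (iterCorona G H k) H

/-- The one-vertex graph `K₁`. -/
def K1 : SimpleGraph PUnit.{u + 1} := ⊤

/-- The number of vertices of degree one. -/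
def numLeaves {V : Type u} [Fintype V] (G : SimpleGraph V) [DecidableRel G.Adj] : ℕ :=
  (Finset.univ.filter fun v : V => G.degree v = 1).card

end MetricDimension

namespace MetricDimension

universe u

open SimpleGraph

variable {V : Type u} {G : SimpleGraph V}

/-! For suitable `G`, the dimension of `G ⊙ K₁` is the number of leaves of `G` (`metricDim_corona`).
Two properties suffice: geodesics prolong to leaves, and no two leaves are adjacent. Upper bound:
prolonging a geodesic from `b` through `a` to a leaf `l` makes `a` strictly closer to `l` than `b`,
so the leaves of `G` resolve. Lower bound: a leaf `l` with neighbour `w` and the pendant vertex at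
`w` are separated only by `l` and the pendants at `l` and `w`; this yields an injection from the
leaves into any resolving set. Trees of order at least 3 have both properties. So does any `G ⊙ K₁`
with `G` connected and nontrivial, its leaves being the pendants, one per vertex of `G`; hence two
coronas have dimension `|V(G)|`, and each corona doubles the order. -/

/-- The set of vertices with exactly one neighbour. -/
def leaves (G : SimpleGraph V) : Set V := {v | ∃! w, G.Adj v w}

theorem encard_leaves [Fintype V] (G : SimpleGraph V) [DecidableRel G.Adj] :
    (leaves G).encard = (numLeaves G : ℕ∞) := by
  have h : leaves G = (Finset.univ.filter fun v : V => G.degree v = 1 : Finset V) := by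
    ext v
    simp [leaves, degree_eq_one_iff_existsUnique_adj]
  rw [h, Set.encard_coe_eq_coe_finsetCard, numLeaves]

theorem dist_eq_succ_of_unique_adj (hG : G.Connected) {l w y : V} (hlw : G.Adj l w)
    (hu : ∀ z, G.Adj l z → z = w) (hy : y ≠ l) : G.dist l y = G.dist w y + 1 := by
  apply le_antisymm
  · have := hG.dist_triangle (u := l) (v := w) (w := y)
    rw [dist_eq_one_iff_adj.2 hlw] at this
    omega
  · obtain ⟨p, hp⟩ := hG.exists_walk_length_eq_dist l y
    cases p with
    | nil => exact absurd rfl hy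
    | cons h q =>
      obtain rfl := hu _ h
      rw [← hp, Walk.length_cons]
      exact Nat.succ_le_succ (dist_le q)

/-! ### The corona product with `K₁` -/

theorem corona_inr_adj_iff {a : V} {x : PUnit.{u + 1}} {z : V ⊕ (V × PUnit.{u + 1})} :
    (corona G K1).Adj (Sum.inr (a, x)) z ↔ z = Sum.inl a := by
  rcases z with b | ⟨b, y⟩
  · change a = b ↔ _
    simp [eq_comm]
  · change (a = b ∧ K1.Adj x y) ↔ _
    simp

theorem corona_inl_adj_inr {a b : V} {x : PUnit.{u + 1}} :
    (corona G K1).Adj (Sum.inl a) (Sum.inr (b, x)) ↔ a = b := Iff.rfl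

theorem corona_inl_adj_inl {a b : V} :
    (corona G (K1 : SimpleGraph PUnit.{u + 1})).Adj (Sum.inl a) (Sum.inl b) ↔ G.Adj a b :=
  Iff.rfl

/-- The inclusion of a graph into its corona product with `K₁`. -/
def coronaInl (G : SimpleGraph V) : G →g corona G (K1 : SimpleGraph PUnit.{u + 1}) where
  toFun := Sum.inl
  map_rel' h := h

/-- The vertex of `G` to which a vertex of the corona product belongs. -/
def base : V ⊕ (V × PUnit.{u + 1}) → V := Sum.elim id Prod.fst

theorem corona_connected (hG : G.Connected) :
    (corona G (K1 : SimpleGraph PUnit.{u + 1})).Connected := by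
  have hne := hG.nonempty
  have h : ∀ z, (corona G (K1 : SimpleGraph PUnit.{u + 1})).Reachable z (Sum.inl (base z)) := by
    rintro (a | ⟨a, x⟩)
    · exact Reachable.refl _
    · exact (corona_inr_adj_iff.2 rfl).reachable
  rw [connected_iff]
  refine ⟨fun y z => (h y).trans (Reachable.trans ?_ (h z).symm), ⟨Sum.inl hne.some⟩⟩
  exact (hG.preconnected (base y) (base z)).map (coronaInl G)

theorem dist_base_le_length (hG : G.Connected) {y z : V ⊕ (V × PUnit.{u + 1})}
    (p : (corona G K1).Walk y z) : G.dist (base y) (base z) ≤ p.length := by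
  induction p with
  | nil => simp
  | @cons y x z h p ih =>
    have h1 : G.dist (base y) (base x) ≤ 1 := by
      rcases y with a | ⟨a, s⟩ <;> rcases x with b | ⟨b, t⟩
      · exact (dist_eq_one_iff_adj.2 (corona_inl_adj_inl.1 h)).le
      · obtain rfl := corona_inl_adj_inr.1 h
        simp [base]
      · obtain rfl := corona_inl_adj_inr.1 h.symm
        simp [base]
      · exact absurd (corona_inr_adj_iff.1 h) (by simp)
    have h2 := hG.dist_triangle (u := base y) (v := base x) (w := base z)
    rw [Walk.length_cons]
    omega

theorem dist_corona_inl_inl (hG : G.Connected) (a b : V) :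
    (corona G (K1 : SimpleGraph PUnit.{u + 1})).dist (Sum.inl a) (Sum.inl b) = G.dist a b := by
  apply le_antisymm
  · obtain ⟨p, hp⟩ := hG.exists_walk_length_eq_dist a b
    rw [← hp, ← Walk.length_map (coronaInl G)]
    exact dist_le _
  · obtain ⟨p, hp⟩ := (corona_connected hG).exists_walk_length_eq_dist
      (Sum.inl a : V ⊕ (V × PUnit.{u + 1})) (Sum.inl b)
    rw [← hp]
    exact dist_base_le_length hG p

theorem dist_corona_inr (hG : G.Connected) {a : V} {x : PUnit.{u + 1}}
    {y : V ⊕ (V × PUnit.{u + 1})} (hy : y ≠ Sum.inr (a, x)) :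
    (corona G K1).dist (Sum.inr (a, x)) y = (corona G K1).dist (Sum.inl a) y + 1 :=
  dist_eq_succ_of_unique_adj (corona_connected hG) (corona_inr_adj_iff.2 rfl)
    (fun _ h => corona_inr_adj_iff.1 h) hy

theorem dist_corona_inl_inr (hG : G.Connected) (a b : V) (x : PUnit.{u + 1}) :
    (corona G K1).dist (Sum.inl a) (Sum.inr (b, x)) = G.dist a b + 1 := by
  rw [dist_comm, dist_corona_inr hG (by simp), dist_corona_inl_inl hG, dist_comm]

theorem leaves_corona (hG : G.Connected) [Nontrivial V] :
    leaves (corona G (K1 : SimpleGraph PUnit.{u + 1})) = Set.range Sum.inr := by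
  ext z
  constructor
  · rintro ⟨w, -, hw⟩
    rcases z with a | z
    · obtain ⟨b, hb⟩ := hG.preconnected.exists_adj_of_nontrivial a
      have h1 := hw (Sum.inl b) hb
      have h2 := hw (Sum.inr (a, PUnit.unit)) (corona_inl_adj_inr.2 rfl)
      exact absurd (h1.trans h2.symm) (by simp)
    · exact ⟨z, rfl⟩
  · rintro ⟨⟨a, x⟩, rfl⟩
    exact ⟨Sum.inl a, corona_inr_adj_iff.2 rfl, fun _ h => corona_inr_adj_iff.1 h⟩

/-- Every geodesic can be prolonged to a geodesic that ends in a leaf. -/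
def GeodesicsReachLeaves (G : SimpleGraph V) : Prop :=
  ∀ a b : V, a ≠ b → ∃ l ∈ leaves G, G.dist b l = G.dist b a + G.dist a l

theorem geodesicsReachLeaves_corona (hG : G.Connected) [Nontrivial V] :
    GeodesicsReachLeaves (corona G (K1 : SimpleGraph PUnit.{u + 1})) := by
  intro a b hab
  rw [leaves_corona hG]
  rcases a with v | a
  -- The pendant at `v` prolongs the geodesic, unless it is `b` itself; then the pendant at any
  -- other vertex does.
  · by_cases hb : b = Sum.inr (v, PUnit.unit)
    · obtain ⟨w, hw⟩ := exists_ne v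
      refine ⟨_, ⟨(w, PUnit.unit), rfl⟩, ?_⟩
      subst hb
      rw [dist_corona_inr hG (by simpa using hw), dist_corona_inr hG (by simp), dist_self]
      omega
    · refine ⟨_, ⟨(v, PUnit.unit), rfl⟩, ?_⟩
      rw [dist_comm, dist_corona_inr hG hb, dist_comm (v := Sum.inr _), dist_corona_inr hG (by simp),
        dist_self, dist_comm]
  · exact ⟨_, ⟨a, rfl⟩, by simp⟩

/-! ### The metric dimension of the corona product with `K₁` -/

theorem isResolvingSet_image_leaves (hG : G.Connected) [Nontrivial V]
    (hL : GeodesicsReachLeaves G) :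
    IsResolvingSet (corona G (K1 : SimpleGraph PUnit.{u + 1})) (Sum.inl '' leaves G) := by
  -- The `+ 1` is the extra edge from the pendant at `b`; it must be handled also for `a = b`, where
  -- any leaf serves.
  have key : ∀ a b : V, ∃ l ∈ leaves G, G.dist a l < G.dist b l + 1 ∧
      (a ≠ b → G.dist a l < G.dist b l) := by
    intro a b
    by_cases hab : a = b
    · obtain ⟨c, hc⟩ := exists_ne a
      obtain ⟨l, hl, -⟩ := hL c a hc
      exact ⟨l, hl, by simp [hab], fun h => absurd hab h⟩
    · obtain ⟨l, hl, h⟩ := hL a b hab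
      have := hG.pos_dist_of_ne (Ne.symm hab)
      exact ⟨l, hl, by omega, fun _ => by omega⟩
  rintro (a | ⟨a, ⟨⟩⟩) (b | ⟨b, ⟨⟩⟩) hab
  · obtain ⟨l, hl, -, h⟩ := key a b
    refine ⟨_, ⟨l, hl, rfl⟩, ?_⟩
    rw [dist_corona_inl_inl hG, dist_corona_inl_inl hG]
    exact (h (by simpa using hab)).ne
  · obtain ⟨l, hl, h, -⟩ := key a b
    refine ⟨_, ⟨l, hl, rfl⟩, ?_⟩
    rw [dist_corona_inl_inl hG, dist_corona_inr hG (by simp), dist_corona_inl_inl hG]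
    exact h.ne
  · obtain ⟨l, hl, h, -⟩ := key b a
    refine ⟨_, ⟨l, hl, rfl⟩, ?_⟩
    rw [dist_corona_inl_inl hG, dist_corona_inr hG (by simp), dist_corona_inl_inl hG]
    exact h.ne'
  · obtain ⟨l, hl, -, h⟩ := key a b
    refine ⟨_, ⟨l, hl, rfl⟩, ?_⟩
    rw [dist_corona_inr hG (by simp), dist_corona_inr hG (by simp), dist_corona_inl_inl hG,
      dist_corona_inl_inl hG]
    have := h (by simpa using hab)
    omega

theorem dist_corona_inl_leaf (hG : G.Connected) {l w : V} (hlw : G.Adj l w)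
    (hu : ∀ z, G.Adj l z → z = w) {s : V ⊕ (V × PUnit.{u + 1})} (h1 : s ≠ Sum.inl l)
    (h2 : s ≠ Sum.inr (l, PUnit.unit)) :
    (corona G K1).dist (Sum.inl l) s = (corona G K1).dist (Sum.inl w) s + 1 := by
  rcases s with b | ⟨b, ⟨⟩⟩
  · rw [dist_corona_inl_inl hG, dist_corona_inl_inl hG,
      dist_eq_succ_of_unique_adj hG hlw hu (by simpa using h1)]
  · rw [dist_corona_inl_inr hG, dist_corona_inl_inr hG,
      dist_eq_succ_of_unique_adj hG hlw hu (by simpa using h2)]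

theorem encard_leaves_le_of_isResolvingSet (hG : G.Connected)
    (hQ : ∀ l w, G.Adj l w → l ∈ leaves G → w ∉ leaves G) {S : Set (V ⊕ (V × PUnit.{u + 1}))}
    (hS : IsResolvingSet (corona G K1) S) : (leaves G).encard ≤ S.encard := by
  -- The pendant at `w` is chosen only when `S` misses both `l` and its pendant; this makes the
  -- choice injective.
  have key : ∀ l : V, ∃ s, l ∈ leaves G → s ∈ S ∧ (s = Sum.inl l ∨ s = Sum.inr (l, PUnit.unit) ∨
      ∃ w, s = Sum.inr (w, PUnit.unit) ∧ G.Adj l w ∧ Sum.inl l ∉ S ∧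
        Sum.inr (l, PUnit.unit) ∉ S) := by
    intro l
    by_cases hl : l ∈ leaves G
    · obtain ⟨w, hlw, hu⟩ := id hl
      by_cases h1 : Sum.inl l ∈ S
      · exact ⟨_, fun _ => ⟨h1, Or.inl rfl⟩⟩
      by_cases h2 : Sum.inr (l, PUnit.unit) ∈ S
      · exact ⟨_, fun _ => ⟨h2, Or.inr (Or.inl rfl)⟩⟩
      obtain ⟨s, hs, hd⟩ := hS (Sum.inl l) (Sum.inr (w, PUnit.unit)) (by simp)
      refine ⟨s, fun _ => ⟨hs, Or.inr (Or.inr ⟨w, ?_, hlw, h1, h2⟩)⟩⟩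
      by_contra hsw
      refine hd ?_
      rw [dist_corona_inl_leaf hG hlw hu (fun h => h1 (h ▸ hs)) (fun h => h2 (h ▸ hs)),
        dist_corona_inr hG hsw]
    · exact ⟨Sum.inl l, fun h => absurd h hl⟩
  choose f hf using key
  refine Set.encard_le_encard_of_injOn (f := f) (fun l hl => (hf l hl).1) ?_
  intro l hl m hm hlm
  obtain ⟨-, h⟩ := hf l hl
  obtain ⟨-, h'⟩ := hf m hm
  rw [← hlm] at h'
  rcases h with h | h | ⟨w, h, hlw, hl1, hl2⟩ <;> rcases h' with h' | h' | ⟨w', h', hmw, hm1, hm2⟩ <;>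
    rw [h] at h'
  · simpa using h'
  · simp at h'
  · simp at h'
  · simp at h'
  · simpa using h'
  · obtain rfl : l = w' := by simpa using h'
    exact absurd hl (hQ _ _ hmw hm)
  · simp at h'
  · obtain rfl : w = m := by simpa using h'
    exact absurd hm (hQ _ _ hlw hl)
  -- Both leaves hang at `w` and `S` misses them and their pendants, so every `s ∈ S` is reached
  -- from either through `w`.
  · obtain rfl : w = w' := by simpa using h'
    by_contra hne
    obtain ⟨s, hs, hd⟩ := hS (Sum.inl l) (Sum.inl m) (by simpa using hne)
    refine hd ?_
    rw [dist_corona_inl_leaf hG hlw (fun z hz => hl.unique hz hlw) (fun h => hl1 (h ▸ hs))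
        (fun h => hl2 (h ▸ hs)),
      dist_corona_inl_leaf hG hmw (fun z hz => hm.unique hz hmw) (fun h => hm1 (h ▸ hs))
        (fun h => hm2 (h ▸ hs))]

theorem metricDim_corona (hG : G.Connected) [Nontrivial V] (hL : GeodesicsReachLeaves G)
    (hQ : ∀ l w, G.Adj l w → l ∈ leaves G → w ∉ leaves G) :
    metricDim (corona G (K1 : SimpleGraph PUnit.{u + 1})) = (leaves G).encard := by
  apply le_antisymm
  · refine (iInf₂_le _ (isResolvingSet_image_leaves hG hL)).trans_eq ?_
    exact Sum.inl_injective.encard_image _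
  · exact le_iInf₂ fun S hS => encard_leaves_le_of_isResolvingSet hG hQ hS

theorem metricDim_corona_corona (hG : G.Connected) [Nontrivial V] :
    metricDim (corona (corona G (K1 : SimpleGraph PUnit.{u + 1})) (K1 : SimpleGraph PUnit.{u + 1}))
      = ENat.card V := by
  have : Nontrivial (V ⊕ (V × PUnit.{u + 1})) := Sum.inl_injective.nontrivial
  rw [metricDim_corona (corona_connected hG) (geodesicsReachLeaves_corona hG), leaves_corona hG,
    ← Set.image_univ, Sum.inr_injective.encard_image, Set.encard_univ]
  · exact ENat.card_congr (Equiv.prodPUnit V)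
  · rw [leaves_corona hG]
    rintro l w h ⟨⟨a, x⟩, rfl⟩
    rw [corona_inr_adj_iff.1 h]
    simp

/-! ### Trees -/

/-- In a tree, adjacent vertices have different distances to `b`, so `c` and `d` are strictly closer
than `l` and each starts a geodesic from `l` to `b`; paths in a tree are unique. -/
theorem eq_of_adj_of_dist_le (hG : G.IsTree) {b l c d : V} (hc : G.Adj l c) (hd : G.Adj l d)
    (hbc : G.dist b c ≤ G.dist b l) (hbd : G.dist b d ≤ G.dist b l) : c = d := by
  have key : ∀ {c}, G.Adj l c → G.dist b c ≤ G.dist b l → ∃ p : G.Path l b, p.1.snd = c := by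
    intro c hc hbc
    obtain ⟨q, hq⟩ := hG.1.exists_walk_length_eq_dist c b
    have h1 := hG.dist_ne_of_adj b hc
    have h2 := hG.1.dist_triangle (u := b) (v := c) (w := l)
    rw [dist_eq_one_iff_adj.2 hc.symm] at h2
    refine ⟨⟨Walk.cons hc q, Walk.isPath_of_length_eq_dist _ ?_⟩, by simp⟩
    rw [Walk.length_cons, hq, dist_comm, dist_comm (u := l)]
    omega
  obtain ⟨p, rfl⟩ := key hc hbc
  obtain ⟨q, rfl⟩ := key hd hbd
  have := hG.isAcyclic.subsingleton_path l b
  rw [Subsingleton.elim p q]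

theorem geodesicsReachLeaves_of_isTree [Finite V] (hG : G.IsTree) : GeodesicsReachLeaves G := by
  intro a b hab
  have hC := hG.1
  -- A farthest prolongation beyond `a`: a neighbour of `l` farther from `b` would be another one.
  obtain ⟨l, hl, hmax⟩ := Set.exists_max_image {l | G.dist b l = G.dist b a + G.dist a l}
    (G.dist b) (Set.toFinite _) ⟨a, by simp⟩
  have hl' : G.dist b l = G.dist b a + G.dist a l := hl
  refine ⟨l, ?_, hl⟩
  have hle : ∀ c, G.Adj l c → G.dist b c ≤ G.dist b l := by
    intro c hc
    by_contra! hlt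
    have h1 := hC.dist_triangle (u := a) (v := l) (w := c)
    have h2 := hC.dist_triangle (u := b) (v := a) (w := c)
    rw [dist_eq_one_iff_adj.2 hc] at h1
    have := hmax c (by change G.dist b c = _; omega)
    omega
  have : Nontrivial V := ⟨a, b, hab⟩
  obtain ⟨c, hc⟩ := hC.preconnected.exists_adj_of_nontrivial l
  exact ⟨c, hc, fun d hd => eq_of_adj_of_dist_le hG hd hc (hle d hd) (hle c hc)⟩

theorem notMem_leaves_of_adj [Fintype V] (hG : G.Connected) (hV : 3 ≤ Fintype.card V) (l w : V)
    (h : G.Adj l w) (hl : l ∈ leaves G) : w ∉ leaves G := by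
  classical
  intro hw
  obtain ⟨y, hy⟩ : ∃ y, y ∉ ({l, w} : Finset V) := by
    by_contra! hall
    have h1 := Finset.card_le_card (fun y _ => hall y : Finset.univ ⊆ ({l, w} : Finset V))
    have h2 := Finset.card_le_two (a := l) (b := w)
    rw [Finset.card_univ] at h1
    omega
  simp only [Finset.mem_insert, Finset.mem_singleton, not_or] at hy
  have h1 := dist_eq_succ_of_unique_adj hG h (fun z hz => hl.unique hz h) hy.1
  have h2 := dist_eq_succ_of_unique_adj hG h.symm (fun z hz => hw.unique hz h.symm) hy.2
  -- Each of `l` and `w` would be one step farther from `y` than the other.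
  omega

/-! ### The iterated corona product with `K₁` -/

theorem iterCorona_connected (hG : G.Connected) (k : ℕ) :
    (iterCorona G (K1 : SimpleGraph PUnit.{u + 1}) k).Connected := by
  induction k with
  | zero => exact hG
  | succ k ih => exact corona_connected ih

theorem card_iterCoronaVertex [Fintype V] (k : ℕ) :
    ENat.card (IterCoronaVertex V PUnit.{u + 1} k) = ((2 ^ k * Fintype.card V : ℕ) : ℕ∞) := by
  induction k with
  | zero =>
    change ENat.card V = _
    simp
  | succ k ih =>
    change ENat.card (IterCoronaVertex V PUnit.{u + 1} k ⊕
      (IterCoronaVertex V PUnit.{u + 1} k × PUnit.{u + 1})) = _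
    rw [ENat.card_sum, ENat.card_congr (Equiv.prodPUnit _), ih, ← Nat.cast_add]
    congr 1
    ring

end MetricDimension

theorem mainTheorem11 {V : Type*} [Fintype V] (T : SimpleGraph V) [DecidableRel T.Adj]
    (hT : T.IsTree) (hn : 3 ≤ Fintype.card V) :
    MetricDimension.metricDim (MetricDimension.iterCorona T MetricDimension.K1 1) =
        (MetricDimension.numLeaves T : ℕ∞) ∧
      ∀ k : ℕ, 2 ≤ k →
        MetricDimension.metricDim (MetricDimension.iterCorona T MetricDimension.K1 k) =
          ((2 ^ (k - 2) * Fintype.card V : ℕ) : ℕ∞) := by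
  have hV : Nontrivial V := Fintype.one_lt_card_iff_nontrivial.1 (by omega)
  constructor
  · change MetricDimension.metricDim (MetricDimension.corona T MetricDimension.K1) = _
    rw [← MetricDimension.encard_leaves]
    exact MetricDimension.metricDim_corona hT.1 (MetricDimension.geodesicsReachLeaves_of_isTree hT)
      (MetricDimension.notMem_leaves_of_adj hT.1 hn)
  · intro k hk
    obtain ⟨j, rfl⟩ := Nat.exists_eq_add_of_le' hk
    have hcard := MetricDimension.card_iterCoronaVertex (V := V) j
    have : Nontrivial (MetricDimension.IterCoronaVertex V PUnit j) := by
      rw [← ENat.one_lt_card_iff_nontrivial, hcard]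
      have := Nat.one_le_two_pow (n := j)
      exact_mod_cast (by nlinarith : 1 < 2 ^ j * Fintype.card V)
    rw [Nat.add_sub_cancel, ← hcard]
    exact MetricDimension.metricDim_corona_corona (MetricDimension.iterCorona_connected hT.1 j)
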